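/- Let $p$ be a prime and let $C_p$ be the cyclic group of order $p$. A $C_p$-Tambara functor $T$ is given by commutative rings $T(C_p/e)$ and $T(C_p/C_p)$, an action of $C_p$ on $T(C_p/e)$ by ring automorphisms, a ring homomorphism $\mathrm{res}\colon T(C_p/C_p)\to T(C_p/e)$, an additive map $\mathrm{tr}\colon T(C_p/e)\to T(C_p/C_p)$ and a multiplicative map $\mathrm{nm}\colon T(C_p/e)\to T(C_p/C_p)$ with $\mathrm{nm}(0)=0$, $\mathrm{nm}(1)=1$, such that $g\cdot\mathrm{res}(a)=\mathrm{res}(a)$, $\mathrm{tr}(gx)=\mathrm{tr}(x)$, $\mathrm{nm}(gx)=\mathrm{nm}(x)$, $\mathrm{res}\,\mathrm{tr}(x)=\sum_{g} gx$, $\mathrm{res}\,\mathrm{nm}(x)=\prod_{g} gx$, $\mathrm{tr}(x)a=\mathrm{tr}(x\,\mathrm{res}(a))$, and $\mathrm{nm}(x+y)=\mathrm{nm}(x)+\mathrm{nm}(y)+\mathrm{tr}\big(\sum_{S}\prod_{g\in S}gx\prod_{g\notin S}gy\big)$, where $S$ runs over representatives of the translation orbits of proper nonempty subsets of $C_p$.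 Morphisms are pairs of ring homomorphisms commuting with all of this structure. A Tambara ideal $I$ of $T$ is a pair of ideals $I(C_p/e)$, $I(C_p/C_p)$ closed under $\mathrm{res}$, $\mathrm{tr}$, $\mathrm{nm}$ and the action; the product $IJ$ is the Tambara ideal generated by the levelwise products; $P$ is prime if it is proper and $IJ\subseteq P$ implies $I\subseteq P$ or $J\subseteq P$. The Nakaoka spectrum $\mathrm{Spec}(T)$ is the set of primes, ordered by inclusion, with closed sets $V(I)=\{P: I\subseteq P\}$. Let $\tau$ be the image of $\mathrm{tr}$ (an ideal of $T(C_p/C_p)$), let $\Phi^{C_p}T=T(C_p/C_p)/\tau$ with quotient map $q$, and also write $\mathrm{nm}\colon T(C_p/e)\to\Phi^{C_p}T$ for the ring homomorphism $x\mapsto \mathrm{nm}(x)+\tau$. The ghost $\mathrm{gh}(T)$ is the $C_p$-Tambara functor with $\mathrm{gh}(T)(C_p/e)=T(C_p/e)$, $\mathrm{gh}(T)(C_p/C_p)=T(C_p/e)^{C_p}\times\Phi^{C_p}T$, $\mathrm{res}(x,y)=x$, $\mathrm{tr}(x)=(\sum_g gx,0)$, $\mathrm{nm}(x)=(\prod_g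 gx,\mathrm{nm}(x)+\tau)$; for a morphism $f$, $\mathrm{gh}(f)$ is $f$ at level $C_p/e$ and the product of the induced maps at level $C_p/C_p$. The ghost map $\mathrm{gh}_T\colon T\to\mathrm{gh}(T)$ is the identity at level $C_p/e$ and $(\mathrm{res},q)$ at level $C_p/C_p$. The map $\mu_T\colon\mathrm{gh}(\mathrm{gh}(T))\to\mathrm{gh}(T)$ is the identity at level $C_p/e$ and $(x,[(y,z)])\mapsto(x,z)$ at level $C_p/C_p$. Then: 1. The functor $\mathrm{gh}$, with unit $(\mathrm{gh}_T)_T$ and multiplication $(\mu_T)_T$, is a monad on the category of $C_p$-Tambara functors. For every $C_p$-Tambara functor $T$: 2. $\mathrm{gh}_T$ is levelwise integral. 3. $\mathrm{gh}_T$ satisfies going up: for primes $\mathfrak p_0\subsetneq\mathfrak p_1$ of $T$ and a prime $\mathfrak q_0$ of $\mathrm{gh}(T)$ with $\mathrm{gh}_T^{-1}(\mathfrak q_0)=\mathfrak p_0$ there is a prime $\mathfrak q_1\supsetneq\mathfrak q_0$ of $\mathrm{gh}(T)$ with $\mathrm{gh}_T^{-1}(\mathfrak q_1)=\mathfrak p_1$.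 4. Preimage along $\mathrm{gh}_T$ is a well-defined continuous surjection $\mathrm{Spec}(\mathrm{gh}(T))\to\mathrm{Spec}(T)$. 5. Write $(\mathfrak a;\mathfrak b)$ for the Tambara ideal of $\mathrm{gh}(T)$ with levels $\mathfrak a$ and $\mathfrak a^{C_p}\times\mathfrak b$. The primes of $\mathrm{gh}(T)$ are exactly (a) the pairs $(\mathfrak a;\Phi^{C_p}T)$ with $\mathfrak a\subset T(C_p/e)$ a $C_p$-prime ideal (proper, $C_p$-invariant, and such that $x(gy)\in\mathfrak a$ for all $g\in C_p$ implies $x\in\mathfrak a$ or $y\in\mathfrak a$), and (b) the pairs $(\mathrm{nm}^{-1}\mathfrak b;\mathfrak b)$ with $\mathfrak b$ a prime ideal of $\Phi^{C_p}T$. The order is componentwise inclusion. 6. $\mathrm{Spec}(\mathrm{gh}(T))$ is isomorphic as a poset, by writing the $C_p/C_p$-level of a prime as $\mathfrak a\times\mathfrak b$, to the set, ordered by componentwise inclusion, of pairs $(\mathfrak a;\mathfrak b)$ in which either $\mathfrak a$ is a prime ideal of $T(C_p/e)^{C_p}$ and $\mathfrak b=\Phi^{C_p}T$, or $\mathfrak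 b$ is a prime ideal of $\Phi^{C_p}T$ and $\mathfrak a=(\mathrm{nm}^{-1}\mathfrak b)^{C_p}$. In particular there is a bijection $\mathrm{Spec}(T(C_p/e)^{C_p})\amalg\mathrm{Spec}(\Phi^{C_p}T)\leftrightarrow\mathrm{Spec}(\mathrm{gh}(T))$, sending a prime $\mathfrak a$ of $T(C_p/e)^{C_p}$ to the prime with $C_p/C_p$-level $\mathfrak a\times\Phi^{C_p}T$ and a prime $\mathfrak b$ of $\Phi^{C_p}T$ to $(\mathrm{nm}^{-1}\mathfrak b;\mathfrak b)$. -/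

import Mathlib

open CategoryTheory

universe u

/-- The cyclic group of order `p`, written multiplicatively. -/
abbrev Cp (p : ℕ) : Type := Multiplicative (ZMod p)

open scoped Pointwise in
/-- One representative for each orbit of `Cp p`, acting by translation on the proper nonempty
subsets of itself. A subset `s` encodes the two-valued function which is `x` on `s` and `y`
off `s`, so these are the orbits of nonconstant functions from `Cp p` to two symbols. -/
noncomputable def orbitReps (p : ℕ) [Fact p.Prime] : Finset (Finset (Cp p)) :=
  (Finset.univ.filter fun s : Finset (Cp p) => s ≠ ∅ ∧ s ≠ Finset.univ).image
    fun s => (Quotient.mk (MulAction.orbitRel (Cp p) (Finset (Cp p))) s).out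

/-- The element whose transfer is `nm (x + y) - nm x - nm y`. (The transfer does not depend on the
chosen representatives, because translating `s` by `h` acts by `h` on the product.) -/
noncomputable def crossTerm (p : ℕ) [Fact p.Prime] {R : Type u} [CommRing R]
    [MulSemiringAction (Cp p) R] (x y : R) : R :=
  ∑ s ∈ orbitReps p, ∏ g : Cp p, g • (if g ∈ s then x else y)

/-- A `C_p`-Tambara functor, presented by its Lewis diagram: `under` is the value at `C_p/e` with
its Weyl action, `fixed` is the value at `C_p/C_p`, and the axioms are the relations between
restriction, transfer, norm and conjugation (equivariance, the double coset formulas, Frobenius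
reciprocity and Tambara reciprocity for the norm of a sum). -/
structure TambaraFunctor (p : ℕ) [Fact p.Prime] where
  under : Type u
  fixed : Type u
  [underRing : CommRing under]
  [fixedRing : CommRing fixed]
  [weylAction : MulSemiringAction (Cp p) under]
  res : fixed →+* under
  tr : under →+ fixed
  nm : under →*₀ fixed
  smul_res : ∀ (g : Cp p) (a : fixed), g • res a = res a
  tr_smul : ∀ (g : Cp p) (x : under), tr (g • x) = tr x
  nm_smul : ∀ (g : Cp p) (x : under), nm (g • x) = nm x
  res_tr : ∀ x : under, res (tr x) = ∑ g : Cp p, g • x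
  res_nm : ∀ x : under, res (nm x) = ∏ g : Cp p, g • x
  tr_mul : ∀ (x : under) (a : fixed), tr x * a = tr (x * res a)
  nm_add : ∀ x y : under, nm (x + y) = nm x + nm y + tr (crossTerm p x y)

namespace TambaraFunctor

variable {p : ℕ} [Fact p.Prime]

attribute [instance] underRing fixedRing weylAction

/-! ### The category of `C_p`-Tambara functors -/

/-- Morphisms: levelwise ring homomorphisms commuting with all structure maps. -/
@[ext]
structure Hom (S T : TambaraFunctor.{u} p) where
  under : S.under →+* T.under
  fixed : S.fixed →+* T.fixed
  map_smul : ∀ (g : Cp p) (x : S.under), under (g • x) = g • under x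
  map_res : ∀ a : S.fixed, under (S.res a) = T.res (fixed a)
  map_tr : ∀ x : S.under, fixed (S.tr x) = T.tr (under x)
  map_nm : ∀ x : S.under, fixed (S.nm x) = T.nm (under x)

instance : Category (TambaraFunctor.{u} p) where
  Hom S T := Hom S T
  id S :=
    { under := RingHom.id _
      fixed := RingHom.id _
      map_smul := fun _ _ => rfl
      map_res := fun _ => rfl
      map_tr := fun _ => rfl
      map_nm := fun _ => rfl }
  comp f g :=
    { under := g.under.comp f.under
      fixed := g.fixed.comp f.fixed
      map_smul := fun h x => by simp [f.map_smul, g.map_smul]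
      map_res := fun a => by simp [f.map_res, g.map_res]
      map_tr := fun x => by simp [f.map_tr, g.map_tr]
      map_nm := fun x => by simp [f.map_nm, g.map_nm] }

/-! ### Ideals, products of ideals, and the Nakaoka spectrum -/

/-- A Tambara ideal: levelwise ideals closed under all structure maps. -/
@[ext]
structure TIdeal (T : TambaraFunctor.{u} p) where
  under : Ideal T.under
  fixed : Ideal T.fixed
  smul_mem : ∀ (g : Cp p), ∀ x ∈ under, g • x ∈ under
  res_mem : ∀ a ∈ fixed, T.res a ∈ under
  tr_mem : ∀ x ∈ under, T.tr x ∈ fixed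
  nm_mem : ∀ x ∈ under, T.nm x ∈ fixed

namespace TIdeal

variable {S T : TambaraFunctor.{u} p}

/-- Ideals are ordered by levelwise inclusion. -/
instance : PartialOrder (TIdeal T) :=
  PartialOrder.lift (fun I => (I.under, I.fixed)) fun I J h => by
    ext1
    · exact congrArg Prod.fst h
    · exact congrArg Prod.snd h

/-- The improper ideal, which is everything at both levels. -/
instance : Top (TIdeal T) where
  top := ⟨⊤, ⊤, by simp, by simp, by simp, by simp⟩

/-- The smallest Tambara ideal containing the given levelwise subsets. -/
def generate (A : Set T.under) (B : Set T.fixed) : TIdeal T where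
  under := sInf {J | ∃ I : TIdeal T, A ⊆ I.under ∧ B ⊆ I.fixed ∧ I.under = J}
  fixed := sInf {J | ∃ I : TIdeal T, A ⊆ I.under ∧ B ⊆ I.fixed ∧ I.fixed = J}
  smul_mem g x hx := by
    simp only [Submodule.mem_sInf] at hx ⊢
    rintro _ ⟨I, hA, hB, rfl⟩
    exact I.smul_mem g x (hx _ ⟨I, hA, hB, rfl⟩)
  res_mem a ha := by
    simp only [Submodule.mem_sInf] at ha ⊢
    rintro _ ⟨I, hA, hB, rfl⟩
    exact I.res_mem a (ha _ ⟨I, hA, hB, rfl⟩)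
  tr_mem x hx := by
    simp only [Submodule.mem_sInf] at hx ⊢
    rintro _ ⟨I, hA, hB, rfl⟩
    exact I.tr_mem x (hx _ ⟨I, hA, hB, rfl⟩)
  nm_mem x hx := by
    simp only [Submodule.mem_sInf] at hx ⊢
    rintro _ ⟨I, hA, hB, rfl⟩
    exact I.nm_mem x (hx _ ⟨I, hA, hB, rfl⟩)

lemma generate_le_iff (A : Set T.under) (B : Set T.fixed) (I : TIdeal T) :
    generate A B ≤ I ↔ A ⊆ I.under ∧ B ⊆ I.fixed := by
  constructor
  · rintro ⟨h1, h2⟩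
    refine ⟨fun x hx => h1 ?_, fun x hx => h2 ?_⟩ <;>
    · change x ∈ sInf _
      simp only [Submodule.mem_sInf]
      rintro _ ⟨J, hA, hB, rfl⟩
      first | exact hA hx | exact hB hx
  · rintro ⟨hA, hB⟩
    exact ⟨sInf_le ⟨I, hA, hB, rfl⟩, sInf_le ⟨I, hA, hB, rfl⟩⟩

/-- The product of two Tambara ideals: the Tambara ideal generated by the levelwise products. -/
def prod (I J : TIdeal T) : TIdeal T :=
  generate (I.under * J.under : Ideal T.under) (I.fixed * J.fixed : Ideal T.fixed)

lemma prod_le_left (I J : TIdeal T) : prod I J ≤ I :=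
  (generate_le_iff _ _ _).2 ⟨SetLike.coe_subset_coe.2 (Ideal.mul_le_left (I := I.under) (J := J.under)),
    SetLike.coe_subset_coe.2 (Ideal.mul_le_left (I := I.fixed) (J := J.fixed))⟩

lemma prod_le_right (I J : TIdeal T) : prod I J ≤ J :=
  (generate_le_iff _ _ _).2 ⟨SetLike.coe_subset_coe.2 (Ideal.mul_le_right (I := I.under) (J := J.under)),
    SetLike.coe_subset_coe.2 (Ideal.mul_le_right (I := I.fixed) (J := J.fixed))⟩

/-- A Tambara ideal is prime if it is proper and contains a product of two Tambara ideals only if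
it contains one of them. -/
def IsPrime (P : TIdeal T) : Prop :=
  P ≠ ⊤ ∧ ∀ I J : TIdeal T, prod I J ≤ P → I ≤ P ∨ J ≤ P

/-- The preimage of a Tambara ideal along a morphism. -/
def comap (f : S ⟶ T) (I : TIdeal T) : TIdeal S where
  under := I.under.comap (Hom.under f)
  fixed := I.fixed.comap (Hom.fixed f)
  smul_mem g x hx := by
    rw [Ideal.mem_comap] at hx ⊢
    rw [Hom.map_smul]
    exact I.smul_mem g _ hx
  res_mem a ha := by
    rw [Ideal.mem_comap] at ha ⊢
    rw [Hom.map_res]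
    exact I.res_mem _ ha
  tr_mem x hx := by
    rw [Ideal.mem_comap] at hx ⊢
    rw [Hom.map_tr]
    exact I.tr_mem _ hx
  nm_mem x hx := by
    rw [Ideal.mem_comap] at hx ⊢
    rw [Hom.map_nm]
    exact I.nm_mem _ hx

end TIdeal

/-- The set of prime Tambara ideals, ordered by inclusion. -/
abbrev Spec (T : TambaraFunctor.{u} p) : Type u := {P : TIdeal T // P.IsPrime}

/-- The set of primes containing a Tambara ideal. -/
def zeroLocus {T : TambaraFunctor.{u} p} (I : TIdeal T) : Set (Spec T) := {P | I ≤ P.1}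

/-- The Zariski topology on the Nakaoka spectrum: the closed sets are the sets `zeroLocus I`. -/
instance (T : TambaraFunctor.{u} p) : TopologicalSpace (Spec T) :=
  TopologicalSpace.ofClosed (Set.range zeroLocus)
    ⟨⊤, Set.eq_empty_of_forall_notMem fun P hP => P.2.1 (by
      ext1
      · exact top_le_iff.1 hP.1
      · exact top_le_iff.1 hP.2)⟩
    (by
      intro A hA
      refine ⟨TIdeal.generate (⋃ I ∈ {I : TIdeal T | zeroLocus I ∈ A}, (I.under : Set T.under))
        (⋃ I ∈ {I : TIdeal T | zeroLocus I ∈ A}, (I.fixed : Set T.fixed)), ?_⟩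
      ext P
      simp only [zeroLocus, Set.mem_ofPred_eq, TIdeal.generate_le_iff, Set.iUnion_subset_iff,
        Set.mem_sInter]
      constructor
      · rintro ⟨h1, h2⟩ Z hZ
        obtain ⟨I, rfl⟩ := hA hZ
        exact ⟨h1 I hZ, h2 I hZ⟩
      · intro h
        exact ⟨fun I hI => (h _ hI).1, fun I hI => (h _ hI).2⟩)
    (by
      rintro _ ⟨I, rfl⟩ _ ⟨J, rfl⟩
      refine ⟨TIdeal.prod I J, ?_⟩
      ext P
      simp only [zeroLocus, Set.mem_ofPred_eq, Set.mem_union]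
      constructor
      · exact P.2.2 I J
      · intro h
        exact h.elim (TIdeal.prod_le_left I J).trans (TIdeal.prod_le_right I J).trans)

/-- A morphism `f : S ⟶ T` satisfies going up if for all primes `P₀ < P₁` of `S` and every prime
`Q₀` of `T` over `P₀` there is a prime `Q₁ > Q₀` of `T` over `P₁`. -/
def GoingUp {S T : TambaraFunctor.{u} p} (f : S ⟶ T) : Prop :=
  ∀ (P₀ P₁ : Spec S) (Q₀ : Spec T), P₀ < P₁ → TIdeal.comap f Q₀.1 = P₀.1 →
    ∃ Q₁ : Spec T, Q₀ < Q₁ ∧ TIdeal.comap f Q₁.1 = P₁.1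

/-- A morphism is levelwise integral if both of its ring homomorphisms are integral. -/
def LevelwiseIntegral {S T : TambaraFunctor.{u} p} (f : S ⟶ T) : Prop :=
  (Hom.under f).IsIntegral ∧ (Hom.fixed f).IsIntegral

/-- A `C_p`-prime ideal of a commutative ring with `C_p`-action. -/
def IsCpPrime {R : Type u} [CommRing R] [MulSemiringAction (Cp p) R] (a : Ideal R) : Prop :=
  (∀ (g : Cp p), ∀ x ∈ a, g • x ∈ a) ∧ a ≠ ⊤ ∧
    ∀ x y : R, (∀ g : Cp p, x * (g • y) ∈ a) → x ∈ a ∨ y ∈ a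

/-! ### Fixed points and geometric fixed points -/

/-- The ring of `C_p`-fixed points of `T(C_p/e)`. -/
abbrev invariants (T : TambaraFunctor.{u} p) : Subring T.under :=
  FixedPoints.subring T.under (Cp p)

/-- The image of the transfer, an ideal of `T(C_p/C_p)` by Frobenius reciprocity. -/
def transferIdeal (T : TambaraFunctor.{u} p) : Ideal T.fixed where
  carrier := Set.range T.tr
  add_mem' := by
    rintro _ _ ⟨x, rfl⟩ ⟨y, rfl⟩
    exact ⟨x + y, map_add _ _ _⟩
  zero_mem' := ⟨0, map_zero _⟩
  smul_mem' := by
    rintro a _ ⟨x, rfl⟩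
    exact ⟨x * T.res a, by rw [← T.tr_mul, smul_eq_mul, mul_comm]⟩

/-- The geometric fixed points: `T(C_p/C_p)` modulo the image of the transfer. -/
abbrev geomFixed (T : TambaraFunctor.{u} p) : Type u := T.fixed ⧸ T.transferIdeal

lemma mk_tr (T : TambaraFunctor.{u} p) (x : T.under) :
    Ideal.Quotient.mk T.transferIdeal (T.tr x) = 0 :=
  Ideal.Quotient.eq_zero_iff_mem.2 ⟨x, rfl⟩

/-- The ring homomorphism from `T(C_p/e)` to the geometric fixed points induced by the norm. -/
def geomNorm (T : TambaraFunctor.{u} p) : T.under →+* T.geomFixed where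
  toFun x := Ideal.Quotient.mk T.transferIdeal (T.nm x)
  map_one' := by simp
  map_mul' := by simp
  map_zero' := by simp
  map_add' x y := by rw [T.nm_add, map_add, map_add, T.mk_tr, add_zero]

/-- The map induced on geometric fixed points by a morphism. -/
def geomFixedMap {S T : TambaraFunctor.{u} p} (f : S ⟶ T) : S.geomFixed →+* T.geomFixed :=
  Ideal.quotientMap T.transferIdeal (Hom.fixed f) (by
    rintro _ ⟨x, rfl⟩
    exact ⟨Hom.under f x, (Hom.map_tr f x).symm⟩)

/-- The map induced on fixed points by a morphism. -/
def invariantsMap {S T : TambaraFunctor.{u} p} (f : S ⟶ T) : S.invariants →+* T.invariants :=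
  ((Hom.under f).comp S.invariants.subtype).codRestrict T.invariants fun x g => by
    change g • Hom.under f (x : S.under) = Hom.under f (x : S.under)
    rw [← Hom.map_smul f g, x.2 g]

/-- The restriction, with values in the fixed points. -/
def resInvariants (T : TambaraFunctor.{u} p) : T.fixed →+* T.invariants :=
  T.res.codRestrict T.invariants fun a g => T.smul_res g a

/-- The sum over the group. -/
def sumInvariants (T : TambaraFunctor.{u} p) (x : T.under) : T.invariants :=
  ⟨∑ g : Cp p, g • x, fun h => by rw [← T.res_tr]; exact T.smul_res h _⟩

/-- The product over the group. -/
def prodInvariants (T : TambaraFunctor.{u} p) (x : T.under) : T.invariants :=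
  ⟨∏ g : Cp p, g • x, fun h => by rw [← T.res_nm]; exact T.smul_res h _⟩

lemma invariantsMap_sum {S T : TambaraFunctor.{u} p} (f : S ⟶ T) (x : S.under) :
    invariantsMap f (S.sumInvariants x) = T.sumInvariants (Hom.under f x) := by
  refine Subtype.ext ?_
  change Hom.under f (∑ g : Cp p, g • x) = ∑ g : Cp p, g • Hom.under f x
  rw [map_sum]
  exact Finset.sum_congr rfl fun g _ => Hom.map_smul f g x

lemma invariantsMap_prod {S T : TambaraFunctor.{u} p} (f : S ⟶ T) (x : S.under) :
    invariantsMap f (S.prodInvariants x) = T.prodInvariants (Hom.under f x) := by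
  refine Subtype.ext ?_
  change Hom.under f (∏ g : Cp p, g • x) = ∏ g : Cp p, g • Hom.under f x
  rw [map_prod]
  exact Finset.prod_congr rfl fun g _ => Hom.map_smul f g x

lemma geomFixedMap_norm {S T : TambaraFunctor.{u} p} (f : S ⟶ T) (x : S.under) :
    geomFixedMap f (S.geomNorm x) = T.geomNorm (Hom.under f x) :=
  congrArg (Ideal.Quotient.mk T.transferIdeal) (Hom.map_nm f x)

/-! ### The ghost construction -/

/-- The ghost of a `C_p`-Tambara functor. -/
def ghost (T : TambaraFunctor.{u} p) : TambaraFunctor.{u} p where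
  under := T.under
  fixed := T.invariants × T.geomFixed
  res := T.invariants.subtype.comp (RingHom.fst _ _)
  tr :=
    { toFun := fun x => (T.sumInvariants x, 0)
      map_zero' := Prod.ext (Subtype.ext (by simp [sumInvariants])) rfl
      map_add' := fun x y => Prod.ext
        (Subtype.ext (by simp [sumInvariants, Finset.sum_add_distrib])) (by simp) }
  nm :=
    { toFun := fun x => (T.prodInvariants x, T.geomNorm x)
      map_zero' := Prod.ext (Subtype.ext (by
        simp [prodInvariants, (Fact.out : p.Prime).ne_zero])) (map_zero _)
      map_one' := Prod.ext (Subtype.ext (by simp [prodInvariants])) (map_one _)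
      map_mul' := fun x y => Prod.ext
        (Subtype.ext (by simp [prodInvariants, Finset.prod_mul_distrib])) (map_mul _ _ _) }
  smul_res g a := a.1.2 g
  tr_smul g x := Prod.ext (Subtype.ext (by
    change ∑ h : Cp p, h • g • x = ∑ h : Cp p, h • x
    rw [← T.res_tr, ← T.res_tr, T.tr_smul])) rfl
  nm_smul g x := Prod.ext (Subtype.ext (by
    change ∏ h : Cp p, h • g • x = ∏ h : Cp p, h • x
    rw [← T.res_nm, ← T.res_nm, T.nm_smul])) (by
    change Ideal.Quotient.mk T.transferIdeal _ = Ideal.Quotient.mk T.transferIdeal _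
    rw [T.nm_smul])
  res_tr _ := rfl
  res_nm _ := rfl
  tr_mul x a := Prod.ext (Subtype.ext (by
    change (∑ g : Cp p, g • x) * (a.1 : T.under) = ∑ g : Cp p, g • (x * (a.1 : T.under))
    rw [Finset.sum_mul]
    refine Finset.sum_congr rfl fun g _ => ?_
    rw [smul_mul', a.1.2 g])) (zero_mul _)
  nm_add x y := Prod.ext (Subtype.ext (by
    change ∏ g : Cp p, g • (x + y) =
      ∏ g : Cp p, g • x + ∏ g : Cp p, g • y + ∑ g : Cp p, g • crossTerm p x y
    rw [← T.res_nm, ← T.res_nm, ← T.res_nm, ← T.res_tr, T.nm_add, map_add, map_add])) (by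
    change T.geomNorm (x + y) = T.geomNorm x + T.geomNorm y + 0
    rw [map_add, add_zero])

/-- The morphism of ghosts induced by `f`: it is `f` on the underlying level, and the product of the
maps induced on fixed points and on geometric fixed points on the fixed level. -/
def ghostMap {S T : TambaraFunctor.{u} p} (f : S ⟶ T) : Hom S.ghost T.ghost :=
  { under := Hom.under (S := S) (T := T) f
    fixed := (invariantsMap f).prodMap (geomFixedMap f)
    map_smul := Hom.map_smul (S := S) (T := T) f
    map_res := fun _ => rfl
    map_tr := fun x => Prod.ext (invariantsMap_sum f x) (map_zero (geomFixedMap f))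
    map_nm := fun x => Prod.ext (invariantsMap_prod f x) (geomFixedMap_norm f x) }

/-- The ghost construction as a functor. -/
def ghostFunctor (p : ℕ) [Fact p.Prime] :
    TambaraFunctor.{u} p ⥤ TambaraFunctor.{u} p where
  obj T := T.ghost
  map f := ghostMap f
  map_id S := Hom.ext rfl (RingHom.ext fun a => Prod.ext rfl (by
    obtain ⟨a, b⟩ := a
    obtain ⟨b, rfl⟩ := Ideal.Quotient.mk_surjective b
    rfl))
  map_comp f g := Hom.ext rfl (RingHom.ext fun a => Prod.ext rfl (by
    obtain ⟨a, b⟩ := a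
    obtain ⟨b, rfl⟩ := Ideal.Quotient.mk_surjective b
    rfl))

/-- The ghost map: the identity on the underlying level, and restriction paired with the quotient
map on the fixed level. -/
def ghostUnit (T : TambaraFunctor.{u} p) : T ⟶ T.ghost where
  under := RingHom.id T.under
  fixed := T.resInvariants.prod (Ideal.Quotient.mk T.transferIdeal)
  map_smul _ _ := rfl
  map_res _ := rfl
  map_tr x := Prod.ext (Subtype.ext (T.res_tr x)) (T.mk_tr x)
  map_nm x := Prod.ext (Subtype.ext (T.res_nm x)) rfl

/-- The multiplication of the ghost monad: the identity on the underlying level, and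
`(x, [(y, z)]) ↦ (x, z)` on the fixed level. -/
def ghostMul (T : TambaraFunctor.{u} p) : T.ghost.ghost ⟶ T.ghost where
  under := RingHom.id T.under
  fixed := RingHom.prodMap (RingHom.id T.invariants)
    (Ideal.Quotient.lift T.ghost.transferIdeal (RingHom.snd T.invariants T.geomFixed) (by
      rintro _ ⟨x, rfl⟩
      rfl))
  map_smul _ _ := rfl
  map_res _ := rfl
  map_tr _ := rfl
  map_nm _ := rfl

/-- For ideals `a` of `T(C_p/e)` and `b` of the geometric fixed points, `P` is the pair `(a; b)`:
it is `a` on the underlying level and `a^{C_p} × b` on the fixed level. -/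
def IsPair {T : TambaraFunctor.{u} p} (P : TIdeal T.ghost) (a : Ideal T.under)
    (b : Ideal T.geomFixed) : Prop :=
  P.under = a ∧ P.fixed = Ideal.prod (a.comap T.invariants.subtype) b

/-- The poset of pairs `(a; b)` of ideals of `T(C_p/e)` and of the geometric fixed points in which
either `a` is `C_p`-prime and `b` is everything, or `b` is prime and `a` is its preimage under the
norm. The order is componentwise inclusion. -/
abbrev GhostPairs (T : TambaraFunctor.{u} p) : Type u :=
  {c : Ideal T.under × Ideal T.geomFixed //
    (IsCpPrime (p := p) c.1 ∧ c.2 = ⊤) ∨ (c.2.IsPrime ∧ c.1 = c.2.comap T.geomNorm)}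

/-- The analogous poset with prime ideals `a` of the ring of fixed points. -/
abbrev GhostPairsFixed (T : TambaraFunctor.{u} p) : Type u :=
  {c : Ideal T.invariants × Ideal T.geomFixed //
    (c.1.IsPrime ∧ c.2 = ⊤) ∨
      (c.2.IsPrime ∧ c.1 = (c.2.comap T.geomNorm).comap T.invariants.subtype)}

end TambaraFunctor

/-! The fixed level of the ghost is a product ring, so a Tambara ideal there amounts to a triple
`(X, A, C)`: an invariant ideal `X` of the underlying ring, an ideal `A` of the fixed points and an
ideal `C` of the geometric fixed points, with `A ⊆ X`, sums and products over the group of elements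
of `X` lying in `A`, and `nm X ⊆ C`. Inclusions of products can be tested on the three parts.

If the ideal is prime, then `A` is all of `X^{C_p}`: a fixed `y ∈ X` has `y ^ p ∈ A`, its product
over the group, and primality extracts the `p`-th root. If `C` is everything, primality says that
`X` is `C_p`-prime. If `C` is proper, testing on ideals with zero underlying level shows that `C` is
prime, and `(nm⁻¹ C; C) · (0; ⊤) ⊆ P` forces `X = nm⁻¹ C`. This is `TIdeal.IsPrime.isGhostPair`,
with converse `IsGhostPair.isPrime`.

For surjectivity on spectra, put `K = res⁻¹(P.under) ⊇ P.fixed`. If the two agree, `P` is the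
preimage of `(P.under; ⊤)`. Otherwise the colon ideal `c = (P.fixed : K)` is a prime containing all
transfers, its image `b` in the geometric fixed points satisfies `nm⁻¹ b = P.under`, and `P.fixed =
K ∩ c`; so `P` is the preimage of `(P.under; b)`. Going up follows by replacing `b` with `⊤`
whenever that leaves the preimage unchanged.

Passing from `C_p`-primes to primes of the fixed subring is integrality: lying over gives existence,
and the polynomial `∏ (X - g x)` shows that a `C_p`-prime is determined, even as regards order, by
its fixed points. -/

namespace TambaraFunctor

/-! ### `C_p`-prime ideals and the subring of fixed points. -/

section CpPrime

variable {p : ℕ} [Fact p.Prime] {R : Type u} [CommRing R] [MulSemiringAction (Cp p) R]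

/-- The smallest `C_p`-invariant ideal containing `x`. -/
def orbitSpan (p : ℕ) {R : Type u} [CommRing R] [MulSemiringAction (Cp p) R] (x : R) : Ideal R :=
  Ideal.span (Set.range fun g : Cp p => g • x)

lemma mem_orbitSpan_self (x : R) : x ∈ orbitSpan p x :=
  Ideal.subset_span ⟨1, one_smul _ x⟩

lemma orbitSpan_le {x : R} {I : Ideal R} (h : ∀ g : Cp p, g • x ∈ I) : orbitSpan p x ≤ I :=
  Ideal.span_le.2 (by rintro _ ⟨g, rfl⟩; exact h g)

lemma smul_mem_orbitSpan (x : R) (g : Cp p) : ∀ y ∈ orbitSpan p x, g • y ∈ orbitSpan p x := by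
  have : orbitSpan p x ≤ (orbitSpan p x).comap (MulSemiringAction.toRingHom (Cp p) R g) :=
    orbitSpan_le fun h => Ideal.subset_span ⟨g * h, mul_smul g h x⟩
  exact fun y hy => this hy

lemma IsCpPrime.le_or_le {a X Y : Ideal R} (ha : IsCpPrime (p := p) a)
    (hY : ∀ (g : Cp p), ∀ y ∈ Y, g • y ∈ Y) (h : X * Y ≤ a) : X ≤ a ∨ Y ≤ a := by
  by_contra! hc
  obtain ⟨x, hx, hxa⟩ := SetLike.not_le_iff_exists.1 hc.1
  obtain ⟨y, hy, hya⟩ := SetLike.not_le_iff_exists.1 hc.2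
  exact (ha.2.2 x y fun g => h (Ideal.mul_mem_mul hx (hY g y hy))).elim hxa hya

/-- Elements `x`, `y` are tested through the invariant ideals spanned by their orbits, whose
generators multiply to `gx · hy = g (x · (g⁻¹h) y)`. -/
lemma isCpPrime_of_le_or_le {a : Ideal R} (hinv : ∀ (g : Cp p), ∀ x ∈ a, g • x ∈ a) (htop : a ≠ ⊤)
    (h : ∀ X Y : Ideal R, (∀ (g : Cp p), ∀ x ∈ X, g • x ∈ X) → (∀ (g : Cp p), ∀ y ∈ Y, g • y ∈ Y) →
      X * Y ≤ a → X ≤ a ∨ Y ≤ a) : IsCpPrime (p := p) a := by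
  refine ⟨hinv, htop, fun x y hxy => ?_⟩
  refine (h (orbitSpan p x) (orbitSpan p y) (smul_mem_orbitSpan x) (smul_mem_orbitSpan y) ?_).imp
    (fun h => h (mem_orbitSpan_self x)) (fun h => h (mem_orbitSpan_self y))
  rw [orbitSpan, orbitSpan, Ideal.span_mul_span', Ideal.span_le]
  rintro _ ⟨_, ⟨g, rfl⟩, _, ⟨h, rfl⟩, rfl⟩
  have := hinv g _ (hxy (g⁻¹ * h))
  rwa [smul_mul', smul_smul, mul_inv_cancel_left] at this

/-- `C_p`-prime ideals are radical. -/
lemma IsCpPrime.mem_of_pow_mem {a : Ideal R} (ha : IsCpPrime (p := p) a) {x : R} {n : ℕ}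
    (h : x ^ n ∈ a) : x ∈ a := by
  have hle : orbitSpan p x ≤ a.radical := orbitSpan_le fun g => ⟨n, by
    rw [← smul_pow']; exact ha.1 g _ h⟩
  -- The orbit is finite, so its span is finitely generated and a power of it lies in `a`; the
  -- factors are then stripped off one at a time.
  obtain ⟨k, hk⟩ := Ideal.exists_pow_le_of_le_radical_of_fg hle
    (Submodule.fg_span (Set.finite_range _))
  have key : orbitSpan p x ≤ a := by
    induction k with
    | zero => exact absurd (top_le_iff.1 (by simpa using hk)) ha.2.1
    | succ k ih =>
      rw [pow_succ] at hk
      exact (ha.le_or_le (smul_mem_orbitSpan x) hk).elim ih id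
  exact key (mem_orbitSpan_self x)

lemma isCpPrime_of_isPrime {a : Ideal R} (ha : a.IsPrime)
    (hinv : ∀ (g : Cp p), ∀ x ∈ a, g • x ∈ a) : IsCpPrime (p := p) a :=
  isCpPrime_of_le_or_le hinv ha.ne_top fun _ _ _ _ h => ha.mul_le.1 h

lemma IsCpPrime.isPrime_comap_subtype {a : Ideal R} (ha : IsCpPrime (p := p) a) :
    (a.comap (FixedPoints.subring R (Cp p)).subtype).IsPrime := by
  refine ⟨fun h => ha.2.1 ((Ideal.eq_top_iff_one a).2 ?_), fun {x y} hxy => ?_⟩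
  · simpa using (Ideal.eq_top_iff_one _).1 h
  · exact ha.2.2 x y fun g => by rw [y.2 g]; exact hxy

/-- A `C_p`-prime ideal is determined by the fixed points it contains. -/
lemma IsCpPrime.le_of_comap_subtype_le {a b : Ideal R} (hb : IsCpPrime (p := p) b)
    (hinv : ∀ (g : Cp p), ∀ x ∈ a, g • x ∈ a)
    (h : a.comap (FixedPoints.subring R (Cp p)).subtype ≤
      b.comap (FixedPoints.subring R (Cp p)).subtype) : a ≤ b := by
  intro x hx
  -- Modulo `a` the polynomial `∏ (X - g x)` becomes a power of `X`, so its lower coefficients are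
  -- fixed points in `a`, hence lie in `b`. Evaluating at `x` puts a power of `x` in `b`, which is
  -- radical.
  set f := MulSemiringAction.charpoly (Cp p) x with hf
  have hmonic : f.Monic := MulSemiringAction.monic_charpoly _ x
  have hmap : f.map (Ideal.Quotient.mk a) = Polynomial.X ^ Fintype.card (Cp p) := by
    rw [hf, MulSemiringAction.charpoly_eq, Polynomial.map_prod, Finset.prod_congr rfl
      (g := fun _ => Polynomial.X), Finset.prod_const, Finset.card_univ]
    intro g _
    simp [Ideal.Quotient.eq_zero_iff_mem.2 (hinv g x hx)]
  -- The degree survives reduction only if `R ⧸ a` is nontrivial; when `a = ⊤`, the hypothesis `h`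
  -- would put `1` in `b`.
  rcases subsingleton_or_nontrivial (R ⧸ a) with hs | hn
  · rw [Ideal.Quotient.subsingleton_iff] at hs
    subst hs
    exact absurd ((Ideal.eq_top_iff_one b).2 (h (x := 1) (by simp))) hb.2.1
  have hdeg : f.natDegree = Fintype.card (Cp p) := by
    rw [← hmonic.natDegree_map (Ideal.Quotient.mk a), hmap, Polynomial.natDegree_X_pow]
  have hcoeff : ∀ i < f.natDegree, f.coeff i ∈ b := by
    intro i hi
    refine h (x := ⟨f.coeff i, fun g => MulSemiringAction.smul_coeff_charpoly x i g⟩) ?_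
    change f.coeff i ∈ a
    rw [← Ideal.Quotient.eq_zero_iff_mem, ← Polynomial.coeff_map, hmap, Polynomial.coeff_X_pow,
      if_neg (hdeg ▸ hi.ne)]
  have heval : f.eval x = 0 := MulSemiringAction.eval_charpoly _ x
  rw [Polynomial.eval_eq_sum_range, Finset.sum_range_succ, hmonic.coeff_natDegree, one_mul] at heval
  refine hb.mem_of_pow_mem (n := f.natDegree) ?_
  rw [← neg_eq_of_add_eq_zero_right heval]
  exact b.neg_mem (b.sum_mem fun i hi =>
    b.mul_mem_right _ (hcoeff i (Finset.mem_range.1 hi)))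

/-- Every prime ideal of the ring of fixed points is cut out by a `C_p`-prime ideal. -/
lemma exists_isCpPrime_comap_subtype_eq (a : Ideal (FixedPoints.subring R (Cp p))) [ha : a.IsPrime] :
    ∃ c : Ideal R, IsCpPrime (p := p) c ∧ c.comap (FixedPoints.subring R (Cp p)).subtype = a := by
  have : Algebra.IsInvariant (FixedPoints.subring R (Cp p)) R (Cp p) :=
    ⟨fun b hb => ⟨⟨b, hb⟩, rfl⟩⟩
  have : Algebra.IsIntegral (FixedPoints.subring R (Cp p)) R :=
    Algebra.IsInvariant.isIntegral _ R (Cp p)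
  obtain ⟨Q, -, hQ, hQa⟩ := Ideal.exists_ideal_over_prime_of_isIntegral (S := R) a ⊥ (by
    intro x hx
    have : x = 0 := Subtype.ext hx
    simp [this])
  have hmem (x : R) : x ∈ ⨅ g : Cp p, Q.comap (MulSemiringAction.toRingHom (Cp p) R g) ↔
      ∀ g : Cp p, g • x ∈ Q := by
    simp only [Ideal.mem_iInf]; rfl
  -- A prime `Q` over `a` need not be invariant; the intersection of its translates is, and it
  -- contains the same fixed points.
  refine ⟨⨅ g : Cp p, Q.comap (MulSemiringAction.toRingHom (Cp p) R g), ⟨?_, ?_, ?_⟩, ?_⟩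
  · intro g x hx
    rw [hmem] at hx ⊢
    exact fun h => by rw [smul_smul]; exact hx _
  · intro h
    have := (hmem 1).1 (h ▸ trivial) 1
    exact hQ.ne_top ((Ideal.eq_top_iff_one Q).2 (by simpa using this))
  · intro x y hxy
    by_contra! hc
    obtain ⟨g, hg⟩ := not_forall.1 (mt (hmem x).2 hc.1)
    refine hc.2 ((hmem y).2 fun h => ?_)
    have := (hmem _).1 (hxy (g⁻¹ * h)) g
    rw [smul_mul', smul_smul, mul_inv_cancel_left] at this
    exact (hQ.mem_or_mem this).resolve_left hg
  · rw [← hQa]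
    ext x
    rw [Ideal.mem_comap, hmem]
    exact ⟨fun h => by have := h 1; rwa [one_smul] at this, fun h g => by
      change g • (x : R) ∈ Q
      rw [x.2 g]; exact h⟩

end CpPrime

variable {p : ℕ} [Fact p.Prime]

/-! ### Tambara ideals, and those of the ghost as triples. -/

namespace TIdeal

variable {S T : TambaraFunctor.{u} p}

lemma fixed_ne_top_of_ne_top {P : TIdeal T} (h : P ≠ ⊤) : P.fixed ≠ ⊤ := by
  intro hf
  refine h (TIdeal.ext ((Ideal.eq_top_iff_one _).2 ?_) hf)
  simpa using P.res_mem 1 (hf ▸ trivial)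

lemma under_ne_top_of_ne_top {P : TIdeal T} (h : P ≠ ⊤) : P.under ≠ ⊤ := by
  intro hu
  refine fixed_ne_top_of_ne_top h ((Ideal.eq_top_iff_one _).2 ?_)
  simpa using P.nm_mem 1 (hu ▸ trivial)

lemma prod_le_iff {I J K : TIdeal T} :
    prod I J ≤ K ↔ I.under * J.under ≤ K.under ∧ I.fixed * J.fixed ≤ K.fixed :=
  generate_le_iff _ _ _

/-- Extension of ideals is left adjoint to `comap`; this identifies the preimage of a closed set as
closed. -/
lemma generate_image_le_iff_le_comap (f : S ⟶ T) (I : TIdeal S) (Q : TIdeal T) :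
    generate (Hom.under f '' I.under) (Hom.fixed f '' I.fixed) ≤ Q ↔ I ≤ comap f Q := by
  rw [generate_le_iff, Set.image_subset_iff, Set.image_subset_iff]
  rfl

/-- The projection to the fixed points of the fixed level of an ideal of the ghost. -/
def invariantsPart (P : TIdeal T.ghost) : Ideal T.invariants :=
  Ideal.map (RingHom.fst T.invariants T.geomFixed) P.fixed

/-- The projection to the geometric fixed points of the fixed level of an ideal of the ghost. -/
def geomPart (P : TIdeal T.ghost) : Ideal T.geomFixed :=
  Ideal.map (RingHom.snd T.invariants T.geomFixed) P.fixed

lemma ghost_fixed_eq (P : TIdeal T.ghost) :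
    P.fixed = Ideal.prod P.invariantsPart P.geomPart :=
  Ideal.ideal_prod_eq (R := T.invariants) (S := T.geomFixed) P.fixed

lemma mem_ghost_fixed {P : TIdeal T.ghost} {a : T.invariants × T.geomFixed} :
    a ∈ (P.fixed : Ideal (T.invariants × T.geomFixed)) ↔
      a.1 ∈ P.invariantsPart ∧ a.2 ∈ P.geomPart := by
  rw [ghost_fixed_eq P]; rfl

lemma invariantsPart_eq_of_fixed_eq {P : TIdeal T.ghost} {A : Ideal T.invariants}
    {C : Ideal T.geomFixed} (h : P.fixed = Ideal.prod A C) : P.invariantsPart = A :=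
  ((Ideal.prod_inj).1 (P.ghost_fixed_eq.symm.trans h)).1

lemma geomPart_eq_of_fixed_eq {P : TIdeal T.ghost} {A : Ideal T.invariants}
    {C : Ideal T.geomFixed} (h : P.fixed = Ideal.prod A C) : P.geomPart = C :=
  ((Ideal.prod_inj).1 (P.ghost_fixed_eq.symm.trans h)).2

lemma ghost_le_iff {I J : TIdeal T.ghost} : I ≤ J ↔
    I.under ≤ J.under ∧ I.invariantsPart ≤ J.invariantsPart ∧ I.geomPart ≤ J.geomPart := by
  constructor
  · exact fun h => ⟨h.1, Ideal.map_mono (R := T.invariants × T.geomFixed) h.2,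
      Ideal.map_mono (R := T.invariants × T.geomFixed) h.2⟩
  · intro h
    refine ⟨h.1, fun a ha => ?_⟩
    exact mem_ghost_fixed.2 ⟨h.2.1 (mem_ghost_fixed.1 ha).1, h.2.2 (mem_ghost_fixed.1 ha).2⟩

lemma invariantsPart_le (P : TIdeal T.ghost) :
    P.invariantsPart ≤ (P.under : Ideal T.under).comap T.invariants.subtype :=
  fun a ha => P.res_mem (a, 0) (mem_ghost_fixed.2 ⟨ha, zero_mem _⟩)

lemma prodInvariants_mem (P : TIdeal T.ghost) {x : T.under} (hx : x ∈ P.under) :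
    T.prodInvariants x ∈ P.invariantsPart :=
  (mem_ghost_fixed.1 (P.nm_mem x hx)).1

lemma geomNorm_mem (P : TIdeal T.ghost) {x : T.under} (hx : x ∈ P.under) :
    T.geomNorm x ∈ P.geomPart :=
  (mem_ghost_fixed.1 (P.nm_mem x hx)).2

/-- The elements `(a, 0)` and `(0, c)` separate the two factors of the fixed level, so inclusion of
a product is a condition on each factor. -/
lemma ghost_prod_le_iff {I J K : TIdeal T.ghost} : prod I J ≤ K ↔
    I.under * J.under ≤ K.under ∧ I.invariantsPart * J.invariantsPart ≤ K.invariantsPart ∧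
      I.geomPart * J.geomPart ≤ K.geomPart := by
  rw [prod_le_iff]
  refine and_congr_right fun _ => ?_
  rw [Ideal.mul_le, Ideal.mul_le, Ideal.mul_le]
  constructor
  · intro h
    refine ⟨fun a ha b hb => ?_, fun a ha b hb => ?_⟩
    · exact (mem_ghost_fixed.1 (h (a, 0) (mem_ghost_fixed.2 ⟨ha, zero_mem _⟩) (b, 0)
        (mem_ghost_fixed.2 ⟨hb, zero_mem _⟩))).1
    · exact (mem_ghost_fixed.1 (h (0, a) (mem_ghost_fixed.2 ⟨zero_mem _, ha⟩) (0, b)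
        (mem_ghost_fixed.2 ⟨zero_mem _, hb⟩))).2
  · intro h a ha b hb
    exact mem_ghost_fixed.2 ⟨h.1 _ (mem_ghost_fixed.1 ha).1 _ (mem_ghost_fixed.1 hb).1,
      h.2 _ (mem_ghost_fixed.1 ha).2 _ (mem_ghost_fixed.1 hb).2⟩

/-- The ideal of the ghost with underlying level `X` and fixed level `A × C`. -/
def ofGhost (X : Ideal T.under) (A : Ideal T.invariants) (C : Ideal T.geomFixed)
    (hX : ∀ (g : Cp p), ∀ x ∈ X, g • x ∈ X) (hA : ∀ a ∈ A, (a : T.under) ∈ X)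
    (hs : ∀ x ∈ X, T.sumInvariants x ∈ A) (hp : ∀ x ∈ X, T.prodInvariants x ∈ A)
    (hC : ∀ x ∈ X, T.geomNorm x ∈ C) : TIdeal T.ghost where
  under := X
  fixed := Ideal.prod A C
  smul_mem := hX
  res_mem a ha := hA a.1 ha.1
  tr_mem x hx := ⟨hs x hx, zero_mem C⟩
  nm_mem x hx := ⟨hp x hx, hC x hx⟩

/-- The ideal `(X; C)` of the ghost. -/
def ghostPair (X : Ideal T.under) (C : Ideal T.geomFixed)
    (hX : ∀ (g : Cp p), ∀ x ∈ X, g • x ∈ X) (hC : X ≤ C.comap T.geomNorm) : TIdeal T.ghost :=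
  ofGhost X (X.comap T.invariants.subtype) C hX (fun _ h => h)
    (fun x hx => X.sum_mem fun g _ => hX g x hx)
    (fun x hx => by
      change ∏ g : Cp p, g • x ∈ X
      exact X.prod_mem (Finset.mem_univ 1) (hX 1 x hx)) hC

section

variable {X : Ideal T.under} {A : Ideal T.invariants} {C : Ideal T.geomFixed}
    {hX : ∀ (g : Cp p), ∀ x ∈ X, g • x ∈ X}

@[simp] lemma ofGhost_invariantsPart {hA hs hp hC} :
    (ofGhost X A C hX hA hs hp hC).invariantsPart = A :=
  invariantsPart_eq_of_fixed_eq rfl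

@[simp] lemma ofGhost_geomPart {hA hs hp hC} :
    (ofGhost X A C hX hA hs hp hC).geomPart = C :=
  geomPart_eq_of_fixed_eq rfl

lemma ghostPair_invariantsPart {hC} :
    (ghostPair X C hX hC).invariantsPart = X.comap T.invariants.subtype :=
  invariantsPart_eq_of_fixed_eq rfl

lemma ghostPair_geomPart {hC} : (ghostPair X C hX hC).geomPart = C :=
  geomPart_eq_of_fixed_eq rfl

end

end TIdeal

open TIdeal

/-! ### Classification of the primes of the ghost. -/

variable {T : TambaraFunctor.{u} p}

lemma geomNorm_smul (g : Cp p) (x : T.under) : T.geomNorm (g • x) = T.geomNorm x :=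
  congrArg (Ideal.Quotient.mk T.transferIdeal) (T.nm_smul g x)

lemma smul_mem_comap_geomNorm (C : Ideal T.geomFixed) (g : Cp p) (x : T.under)
    (hx : x ∈ C.comap T.geomNorm) : g • x ∈ C.comap T.geomNorm := by
  rw [Ideal.mem_comap, geomNorm_smul]; exact hx

lemma isCpPrime_comap_geomNorm {C : Ideal T.geomFixed} (hC : C.IsPrime) :
    IsCpPrime (p := p) (C.comap T.geomNorm) :=
  isCpPrime_of_isPrime (hC.comap _) (smul_mem_comap_geomNorm C)

/-- The underlying level and the geometric fixed points of a prime of the ghost. -/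
def IsGhostPair (a : Ideal T.under) (b : Ideal T.geomFixed) : Prop :=
  (IsCpPrime (p := p) a ∧ b = ⊤) ∨ (b.IsPrime ∧ a = b.comap T.geomNorm)

lemma IsGhostPair.isCpPrime {a : Ideal T.under} {b : Ideal T.geomFixed} (h : IsGhostPair a b) :
    IsCpPrime (p := p) a := by
  rcases h with h | ⟨hb, rfl⟩
  exacts [h.1, isCpPrime_comap_geomNorm hb]

lemma IsGhostPair.le_comap {a : Ideal T.under} {b : Ideal T.geomFixed} (h : IsGhostPair a b) :
    a ≤ b.comap T.geomNorm := by
  rcases h with ⟨-, rfl⟩ | ⟨-, rfl⟩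
  exacts [fun _ _ => trivial, le_rfl]

/-- The prime `(a; b)` of the ghost. -/
def IsGhostPair.toIdeal {a : Ideal T.under} {b : Ideal T.geomFixed} (h : IsGhostPair a b) :
    TIdeal T.ghost :=
  ghostPair a b h.isCpPrime.1 h.le_comap

lemma IsGhostPair.toIdeal_invariantsPart {a : Ideal T.under} {b : Ideal T.geomFixed}
    (h : IsGhostPair a b) : h.toIdeal.invariantsPart = a.comap T.invariants.subtype :=
  ghostPair_invariantsPart

lemma IsGhostPair.toIdeal_geomPart {a : Ideal T.under} {b : Ideal T.geomFixed}
    (h : IsGhostPair a b) : h.toIdeal.geomPart = b :=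
  ghostPair_geomPart

/-- Only one part decides whether an ideal lies in `(a; b)`: the underlying level if `b = ⊤`, and
the geometric part if `a = nm⁻¹ b`, because the norm maps the underlying level into the geometric
part. Primality of that one part suffices. -/
lemma IsGhostPair.isPrime {a : Ideal T.under} {b : Ideal T.geomFixed} (h : IsGhostPair a b) :
    h.toIdeal.IsPrime := by
  have hle {I : TIdeal T.ghost} (h1 : I.under ≤ a) (h2 : I.geomPart ≤ b) : I ≤ h.toIdeal := by
    refine ghost_le_iff.2 ⟨h1, ?_, ?_⟩
    · rw [h.toIdeal_invariantsPart]
      exact I.invariantsPart_le.trans (Ideal.comap_mono h1)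
    · rw [h.toIdeal_geomPart]; exact h2
  refine ⟨fun ht => h.isCpPrime.2.1 (congrArg TIdeal.under ht), fun I J hIJ => ?_⟩
  obtain ⟨h1, -, h3⟩ := ghost_prod_le_iff.1 hIJ
  rw [h.toIdeal_geomPart] at h3
  rcases h with ⟨ha, rfl⟩ | ⟨hb, rfl⟩
  · exact (ha.le_or_le J.smul_mem h1).imp (fun h => hle h le_top) (fun h => hle h le_top)
  · exact (hb.mul_le.1 h3).imp (fun h => hle (fun x hx => h (I.geomNorm_mem hx)) h)
      (fun h => hle (fun x hx => h (J.geomNorm_mem hx)) h)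

namespace TIdeal.IsPrime

variable {P : TIdeal T.ghost}

/-- A prime of the ghost contains all fixed points of its underlying level. -/
lemma invariantsPart_eq (hP : P.IsPrime) :
    P.invariantsPart = (P.under : Ideal T.under).comap T.invariants.subtype := by
  refine le_antisymm P.invariantsPart_le fun x hx => ?_
  have inv (y : T.invariants) (g : Cp p) : ∀ z ∈ Ideal.span {(y : T.under)},
      g • z ∈ Ideal.span {(y : T.under)} := by
    intro z hz
    obtain ⟨w, rfl⟩ := Ideal.mem_span_singleton.1 hz
    exact Ideal.mem_span_singleton.2 ⟨g • w, by rw [smul_mul', y.2 g]⟩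
  -- The ideal with levels `(y)` and `(y) × (nm y)`. It is closed under transfer and norm because
  -- `y` is fixed: it factors out of a sum over the group, and comes out of a product as `y ^ p`.
  let I (y : T.invariants) : TIdeal T.ghost :=
    ofGhost (Ideal.span {(y : T.under)}) (Ideal.span {y}) (Ideal.span {T.geomNorm y}) (inv y)
      (by
        intro a ha
        obtain ⟨w, rfl⟩ := Ideal.mem_span_singleton.1 ha
        exact Ideal.mem_span_singleton.2 ⟨w, rfl⟩)
      (by
        intro a ha
        obtain ⟨w, rfl⟩ := Ideal.mem_span_singleton.1 ha
        refine Ideal.mem_span_singleton.2 ⟨T.sumInvariants w, Subtype.ext ?_⟩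
        change ∑ g : Cp p, g • ((y : T.under) * w) = (y : T.under) * ∑ g : Cp p, g • w
        rw [Finset.mul_sum]
        exact Finset.sum_congr rfl fun g _ => by rw [smul_mul', y.2 g])
      (by
        intro a ha
        obtain ⟨w, rfl⟩ := Ideal.mem_span_singleton.1 ha
        have : T.prodInvariants (y * w) = y ^ Fintype.card (Cp p) * T.prodInvariants w := by
          refine Subtype.ext ?_
          change ∏ g : Cp p, g • ((y : T.under) * w) =
            (y : T.under) ^ Fintype.card (Cp p) * ∏ g : Cp p, g • w
          rw [← Finset.card_univ, ← Finset.prod_const, ← Finset.prod_mul_distrib]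
          exact Finset.prod_congr rfl fun g _ => by rw [smul_mul', y.2 g]
        rw [this]
        exact Ideal.mul_mem_right _ _ (Ideal.pow_mem_of_mem _ (Ideal.mem_span_singleton_self y) _
          Fintype.card_pos))
      (by
        intro a ha
        obtain ⟨w, rfl⟩ := Ideal.mem_span_singleton.1 ha
        exact Ideal.mem_span_singleton.2 ⟨T.geomNorm w, map_mul _ _ _⟩)
  -- Since `I (x ^ (n + 1)) · I x ≤ I (x ^ (n + 2))`, primality lowers the exponent one step at a
  -- time. The shift by one makes the descent stop at `x` rather than at `1`.
  have hI (n : ℕ) : I (x ^ (n + 1)) ≤ P → I x ≤ P := by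
    induction n with
    | zero => intro h; rwa [zero_add, pow_one] at h
    | succ n ih =>
      intro h
      refine (hP.2 (I (x ^ (n + 1))) (I x) ?_).elim ih id
      refine le_trans (ghost_prod_le_iff.2 ⟨?_, ?_, ?_⟩) h
      · refine (Ideal.span_singleton_mul_span_singleton _ _).trans_le (le_of_eq ?_)
        change _ = Ideal.span {((x ^ (n + 1 + 1) : T.invariants) : T.under)}
        rw [pow_succ x (n + 1)]; rfl
      · simp only [I, ofGhost_invariantsPart, Ideal.span_singleton_mul_span_singleton]
        rw [← pow_succ]
      · simp only [I, ofGhost_geomPart, Ideal.span_singleton_mul_span_singleton]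
        rw [← map_mul, ← Subring.coe_mul, ← pow_succ]
  -- The product over the group of a fixed `x` is `x ^ p`, the power from which the descent starts.
  have hpow : x ^ Fintype.card (Cp p) ∈ P.invariantsPart := by
    have : T.prodInvariants x = x ^ Fintype.card (Cp p) := by
      refine Subtype.ext ?_
      change ∏ g : Cp p, g • (x : T.under) = (x : T.under) ^ Fintype.card (Cp p)
      rw [← Finset.card_univ, ← Finset.prod_const]
      exact Finset.prod_congr rfl fun g _ => x.2 g
    rw [← this]
    exact P.prodInvariants_mem hx
  obtain ⟨n, hn⟩ := Nat.exists_eq_succ_of_ne_zero (Fintype.card_ne_zero (α := Cp p))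
  have hle : I (x ^ (n + 1)) ≤ P := by
    rw [← Nat.succ_eq_add_one, ← hn]
    refine ghost_le_iff.2 ⟨?_, ?_, ?_⟩
    · exact (Ideal.span_singleton_le_iff_mem _).2 (P.invariantsPart_le hpow)
    · simp only [I, ofGhost_invariantsPart]
      exact (Ideal.span_singleton_le_iff_mem _).2 hpow
    · simp only [I, ofGhost_geomPart]
      exact (Ideal.span_singleton_le_iff_mem _).2 (P.geomNorm_mem (P.invariantsPart_le hpow))
  have := (ghost_le_iff.1 (hI n hle)).2.1
  simp only [I, ofGhost_invariantsPart] at this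
  exact this (Ideal.mem_span_singleton_self x)

/-- A prime of the ghost is one of the pairs `(a; b)`. -/
lemma isGhostPair (hP : P.IsPrime) : IsGhostPair (T := T) P.under P.geomPart := by
  have zero_inv (g : Cp p) (x : T.under) (hx : x ∈ (⊥ : Ideal T.under)) :
      g • x ∈ (⊥ : Ideal T.under) := by
    rw [Ideal.mem_bot] at hx ⊢; rw [hx, smul_zero]
  have zero_le (C : Ideal T.geomFixed) : (⊥ : Ideal T.under) ≤ C.comap T.geomNorm := bot_le
  have le_comap_top (X : Ideal T.under) : X ≤ (⊤ : Ideal T.geomFixed).comap T.geomNorm :=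
    fun _ _ => trivial
  have bot_comap : (⊥ : Ideal T.under).comap T.invariants.subtype = ⊥ :=
    (RingHom.injective_iff_ker_eq_bot _).1 Subtype.val_injective
  have bot_pair (C : Ideal T.geomFixed) (I : TIdeal T.ghost) :
      ghostPair ⊥ C zero_inv (zero_le C) ≤ I ↔ C ≤ I.geomPart := by
    rw [ghost_le_iff, ghostPair_geomPart, ghostPair_invariantsPart, bot_comap]
    exact ⟨fun h => h.2.2, fun h => ⟨bot_le, bot_le, h⟩⟩
  by_cases hB : P.geomPart = ⊤
  · refine Or.inl ⟨isCpPrime_of_le_or_le P.smul_mem (under_ne_top_of_ne_top hP.1) ?_, hB⟩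
    intro X Y hX hY hXY
    refine (hP.2 (ghostPair X ⊤ hX (le_comap_top X)) (ghostPair Y ⊤ hY (le_comap_top Y))
      (ghost_prod_le_iff.2 ⟨hXY, ?_, ?_⟩)).imp (fun h => h.1) (fun h => h.1)
    · rw [hP.invariantsPart_eq, ghostPair_invariantsPart, ghostPair_invariantsPart]
      exact (Ideal.le_comap_mul _).trans (Ideal.comap_mono hXY)
    · rw [hB]; exact le_top
  · refine Or.inr ⟨⟨hB, fun {x y} hxy => ?_⟩, ?_⟩
    -- Primality of the geometric part is tested on the ideals `(0; C)` and `(0; D)`, which are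
    -- Tambara ideals for arbitrary `C` and `D`.
    · rw [← Ideal.span_singleton_le_iff_mem, ← Ideal.span_singleton_mul_span_singleton] at hxy
      rw [← Ideal.span_singleton_le_iff_mem, ← Ideal.span_singleton_le_iff_mem _ (x := y)]
      generalize Ideal.span {x} = C at hxy ⊢
      generalize Ideal.span {y} = D at hxy ⊢
      refine (hP.2 (ghostPair ⊥ C zero_inv (zero_le C)) (ghostPair ⊥ D zero_inv (zero_le D))
        (ghost_prod_le_iff.2 ⟨?_, ?_, ?_⟩)).imp (bot_pair _ _).1 (bot_pair _ _).1
      · exact (Ideal.bot_mul _).trans_le bot_le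
      · rw [ghostPair_invariantsPart, bot_comap, Ideal.bot_mul]; exact bot_le
      · rw [ghostPair_geomPart, ghostPair_geomPart]; exact hxy
    · refine le_antisymm (fun x hx => P.geomNorm_mem hx) ?_
      -- The product `(nm⁻¹ C; C) · (0; ⊤)`, with `C` the geometric part, lies in `P`, while `(0;
      -- ⊤)` does not since `C` is proper.
      refine ((hP.2 (ghostPair (P.geomPart.comap T.geomNorm) P.geomPart
        (smul_mem_comap_geomNorm _) le_rfl) (ghostPair ⊥ ⊤ zero_inv (zero_le ⊤))
        (ghost_prod_le_iff.2 ⟨?_, ?_, ?_⟩)).resolve_right fun h => ?_).1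
      · exact (Ideal.mul_bot _).trans_le bot_le
      · rw [ghostPair_invariantsPart (X := ⊥), bot_comap, Ideal.mul_bot]; exact bot_le
      · rw [ghostPair_geomPart, ghostPair_geomPart]; exact (Ideal.mul_top _).le
      · exact hB (top_le_iff.1 ((bot_pair _ _).1 h))

lemma isPair (hP : P.IsPrime) : IsPair (T := T) P P.under P.geomPart :=
  ⟨rfl, P.ghost_fixed_eq.trans (congrArg (Ideal.prod · P.geomPart) hP.invariantsPart_eq)⟩

end TIdeal.IsPrime

lemma IsGhostPair.toIdeal_le_iff {a a' : Ideal T.under} {b b' : Ideal T.geomFixed}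
    (h : IsGhostPair a b) (h' : IsGhostPair a' b') :
    h.toIdeal ≤ h'.toIdeal ↔ a ≤ a' ∧ b ≤ b' := by
  rw [ghost_le_iff, h.toIdeal_invariantsPart, h'.toIdeal_invariantsPart, h.toIdeal_geomPart,
    h'.toIdeal_geomPart]
  exact ⟨fun hle => ⟨hle.1, hle.2.2⟩, fun hle => ⟨hle.1, Ideal.comap_mono hle.1, hle.2⟩⟩

lemma TIdeal.IsPrime.eq_toIdeal {P : TIdeal T.ghost} (hP : P.IsPrime) :
    P = hP.isGhostPair.toIdeal :=
  TIdeal.ext rfl hP.isPair.2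

/-! ### Primes of `T` as preimages of primes of the ghost. -/

/-- The preimage of a prime of the ghost along the ghost map is prime. -/
lemma IsGhostPair.isPrime_comap {a : Ideal T.under} {b : Ideal T.geomFixed}
    (h : IsGhostPair a b) : (comap T.ghostUnit h.toIdeal).IsPrime := by
  have hle {I : TIdeal T} (h1 : I.under ≤ a)
      (h2 : ∀ t ∈ I.fixed, Ideal.Quotient.mk T.transferIdeal t ∈ b) :
      I ≤ comap T.ghostUnit h.toIdeal :=
    ⟨h1, fun t ht => ⟨h1 (I.res_mem t ht), h2 t ht⟩⟩
  refine ⟨fun ht => h.isCpPrime.2.1 (congrArg TIdeal.under ht), fun I J hIJ => ?_⟩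
  obtain ⟨h1, h2⟩ := prod_le_iff.1 hIJ
  rcases h with ⟨ha, rfl⟩ | ⟨hb, rfl⟩
  · exact (ha.le_or_le J.smul_mem h1).imp (fun h => hle h fun _ _ => trivial)
      (fun h => hle h fun _ _ => trivial)
  · have hmul : I.fixed * J.fixed ≤ b.comap (Ideal.Quotient.mk T.transferIdeal) :=
      fun t ht => (h2 ht).2
    rcases (hb.comap (Ideal.Quotient.mk T.transferIdeal)).mul_le.1 hmul with h | h
    · exact Or.inl (hle (fun x hx => h (I.nm_mem x hx)) fun t ht => h ht)
    · exact Or.inr (hle (fun x hx => h (J.nm_mem x hx)) fun t ht => h ht)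

/-- If `b` contains the image of the kernel of the restriction, then `(a; b)` and `(a; ⊤)` have the
same preimage along the ghost map. -/
lemma IsGhostPair.mk_mem_of_res_mem {a : Ideal T.under} {b : Ideal T.geomFixed}
    (h : IsGhostPair a b)
    (hker : ∀ t : T.fixed, T.res t = 0 → Ideal.Quotient.mk T.transferIdeal t ∈ b)
    (t : T.fixed) (ht : T.res t ∈ a) : Ideal.Quotient.mk T.transferIdeal t ∈ b := by
  rcases h with ⟨-, rfl⟩ | ⟨hb, rfl⟩
  · trivial
  -- The elements `nm (res t)` and `t ^ p` have the same restriction, so they agree modulo `b`; the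
  -- first lies in `b` because `res t ∈ nm⁻¹ b`.
  · have hres : T.res (T.nm (T.res t) - t ^ Fintype.card (Cp p)) = 0 := by
      rw [map_sub, T.res_nm, map_pow, sub_eq_zero, ← Finset.card_univ, ← Finset.prod_const]
      exact Finset.prod_congr rfl fun g _ => T.smul_res g t
    have h1 := hker _ hres
    rw [map_sub, map_pow] at h1
    exact hb.mem_of_pow_mem _ ((b.sub_mem_iff_right ht).1 h1)

/-- Every prime is the preimage of a prime of the ghost along the ghost map. -/
lemma TIdeal.IsPrime.exists_comap_eq {P : TIdeal T} (hP : P.IsPrime) :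
    ∃ (b : Ideal T.geomFixed) (h : IsGhostPair P.under b),
      comap T.ghostUnit h.toIdeal = P := by
  by_cases hK : P.under.comap T.res ≤ P.fixed
  -- The largest Tambara ideal with underlying level `X`. Here `P` itself is of this form, so such
  -- ideals suffice to test its underlying level.
  · let I (X : Ideal T.under) (hX : ∀ (g : Cp p), ∀ x ∈ X, g • x ∈ X) : TIdeal T :=
      { under := X
        fixed := X.comap T.res
        smul_mem := hX
        res_mem := fun _ h => h
        tr_mem := fun x hx => by
          rw [Ideal.mem_comap, T.res_tr]
          exact X.sum_mem fun g _ => hX g x hx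
        nm_mem := fun x hx => by
          rw [Ideal.mem_comap, T.res_nm]
          exact X.prod_mem (Finset.mem_univ 1) (hX 1 x hx) }
    have ha : IsCpPrime (p := p) P.under :=
      isCpPrime_of_le_or_le P.smul_mem (under_ne_top_of_ne_top hP.1) fun X Y hX hY hXY =>
        (hP.2 (I X hX) (I Y hY) (prod_le_iff.2 ⟨hXY,
          (Ideal.le_comap_mul _).trans ((Ideal.comap_mono hXY).trans hK)⟩)).imp
          (fun h => h.1) (fun h => h.1)
    exact ⟨⊤, Or.inl ⟨ha, rfl⟩, TIdeal.ext rfl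
      (le_antisymm (fun t ht => hK ht.1) fun t ht => ⟨P.res_mem t ht, trivial⟩)⟩
  · set K : Ideal T.fixed := P.under.comap T.res
    -- The colon ideal contains transfers by Frobenius reciprocity: `tr x · k = tr (x · res k)`, and
    -- `res k ∈ P.under` for `k ∈ K`.
    let c : Ideal T.fixed := P.fixed.colon (K : Set T.fixed)
    have mem_c {t : T.fixed} : t ∈ c ↔ ∀ k ∈ K, t * k ∈ P.fixed := Submodule.mem_colon
    have hPc : P.fixed ≤ c := fun t ht => mem_c.2 fun k _ => P.fixed.mul_mem_right k ht
    have htr (x : T.under) : T.tr x ∈ c := mem_c.2 fun k hk => by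
      rw [T.tr_mul]
      exact P.tr_mem _ (P.under.mul_mem_left x hk)
    have hτ : T.transferIdeal ≤ c := by
      rintro _ ⟨x, rfl⟩
      exact htr x
    -- Every ideal `L` between `P.fixed` and `K` forms a Tambara ideal with `P.under`, so primality
    -- of `P` applies to products of such `L`.
    let I (L : Ideal T.fixed) (h1 : P.fixed ≤ L) (h2 : L ≤ K) : TIdeal T :=
      { under := P.under
        fixed := L
        smul_mem := P.smul_mem
        res_mem := fun _ h => h2 h
        tr_mem := fun x hx => h1 (P.tr_mem x hx)
        nm_mem := fun x hx => h1 (P.nm_mem x hx) }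
    have hPK : P.fixed ≤ K := fun t ht => P.res_mem t ht
    have hc : c.IsPrime := by
      refine ⟨fun h => hK fun k hk => ?_, fun {s t} hst => ?_⟩
      · simpa using mem_c.1 ((Ideal.eq_top_iff_one c).1 h) k hk
      -- An element `r` lies in `c` exactly when `P.fixed + (r) K` collapses to `P.fixed`; for `s t
      -- ∈ c` the product of the ideals attached to `s` and `t` lies in `P`.
      · have hL (r : T.fixed) : P.fixed ⊔ Ideal.span {r} * K ≤ K := sup_le hPK Ideal.mul_le_right
        have hmem {r : T.fixed} (h : P.fixed ⊔ Ideal.span {r} * K ≤ P.fixed) : r ∈ c :=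
          mem_c.2 fun k hk =>
            h (Ideal.mem_sup_right (Ideal.mul_mem_mul (Ideal.mem_span_singleton_self r) hk))
        refine (hP.2 (I _ le_sup_left (hL s)) (I _ le_sup_left (hL t))
          (prod_le_iff.2 ⟨Ideal.mul_le_left, ?_⟩)).imp (fun h => hmem h.2) (fun h => hmem h.2)
        change (P.fixed ⊔ Ideal.span {s} * K) * (P.fixed ⊔ Ideal.span {t} * K) ≤ P.fixed
        rw [Ideal.sup_mul, Ideal.mul_sup (Ideal.span {s} * K)]
        refine sup_le Ideal.mul_le_left (sup_le Ideal.mul_le_right ?_)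
        rw [mul_mul_mul_comm, Ideal.span_singleton_mul_span_singleton, Ideal.mul_le]
        intro r hr k hk
        obtain ⟨w, rfl⟩ := Ideal.mem_span_singleton.1 hr
        exact mem_c.1 (c.mul_mem_right w hst) k (Ideal.mul_le_left hk)
    set b : Ideal T.geomFixed := c.map (Ideal.Quotient.mk T.transferIdeal)
    have hcomap : b.comap (Ideal.Quotient.mk T.transferIdeal) = c :=
      Ideal.comap_map_mk hτ
    have hmk {t : T.fixed} : Ideal.Quotient.mk T.transferIdeal t ∈ b ↔ t ∈ c := by
      rw [← Ideal.mem_comap, hcomap]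
    have hbprime : b.IsPrime := Ideal.map_isPrime_of_surjective Ideal.Quotient.mk_surjective
      (by rwa [Ideal.mk_ker])
    have hunder : P.under = b.comap T.geomNorm := by
      refine le_antisymm (fun x hx => hmk.2 (hPc (P.nm_mem x hx))) fun x hx => ?_
      set X := orbitSpan p x
      have hXb : X ≤ b.comap T.geomNorm :=
        orbitSpan_le fun g => smul_mem_comap_geomNorm b g x hx
      -- The fixed level of `J` lies in `c`, so `J · (P.under; K) ≤ P`. As `K` is not inside
      -- `P.fixed`, primality gives `J ≤ P`, hence `x ∈ P.under`.
      let J : TIdeal T :=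
        { under := X
          fixed := c ⊓ X.comap T.res
          smul_mem := smul_mem_orbitSpan x
          res_mem := fun _ h => h.2
          tr_mem := fun y hy => ⟨htr y, by
            rw [SetLike.mem_coe, Ideal.mem_comap, T.res_tr]
            exact X.sum_mem fun g _ => smul_mem_orbitSpan x g y hy⟩
          nm_mem := fun y hy => ⟨hmk.1 (hXb hy), by
            rw [SetLike.mem_coe, Ideal.mem_comap, T.res_nm]
            exact X.prod_mem (Finset.mem_univ 1) (smul_mem_orbitSpan x 1 y hy)⟩ }
      refine ((hP.2 J (I K hPK le_rfl) (prod_le_iff.2 ⟨Ideal.mul_le_right, ?_⟩)).resolve_right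
        fun h => hK h.2).1 (mem_orbitSpan_self x)
      exact Ideal.mul_le.2 fun r hr k hk => mem_c.1 hr.1 k hk
    have hfixed : P.fixed = K ⊓ c := by
      refine le_antisymm (le_inf hPK hPc) ?_
      -- The square of `K ∩ c` lies in `c K`, hence in `P.fixed`.
      have := hP.2 (I _ (le_inf hPK hPc) inf_le_left) (I _ (le_inf hPK hPc) inf_le_left)
        (prod_le_iff.2 ⟨Ideal.mul_le_left,
          Ideal.mul_le.2 fun r hr k hk => mem_c.1 hr.2 k hk.1⟩)
      exact this.elim (fun h => h.2) (fun h => h.2)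
    refine ⟨b, Or.inr ⟨hbprime, hunder⟩, TIdeal.ext rfl ?_⟩
    refine le_antisymm (fun t ht => ?_) fun t ht => ?_
    · rw [hfixed]; exact ⟨ht.1, hmk.1 ht.2⟩
    · exact ⟨hPK ht, hmk.2 (hPc ht)⟩

/-! ### Going up, integrality and continuity. -/

/-- The prime over `P₁` must be chosen to contain `Q₀`. If `b₁` contains the image of `ker res`, the
larger prime `(P₁.under; ⊤)` also lies over `P₁` and serves. Otherwise some `t ∈ ker res` is nonzero
modulo `b₁`, and multiplying by `t` forces the geometric part of `Q₀` into `b₁`. -/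
lemma goingUp_ghostUnit (T : TambaraFunctor.{u} p) : GoingUp T.ghostUnit := by
  rintro ⟨P₀, hP₀⟩ ⟨P₁, hP₁⟩ ⟨Q₀, hQ₀⟩ hlt hQP
  change comap T.ghostUnit Q₀ = P₀ at hQP
  subst hQP
  obtain ⟨b₁, h₁, hQ₁⟩ := hP₁.exists_comap_eq
  have hle : comap T.ghostUnit Q₀ ≤ P₁ := hlt.le
  have hne : comap T.ghostUnit Q₀ ≠ P₁ := fun h => hlt.ne (Subtype.ext h)
  obtain ⟨b, h, hQ, hb⟩ : ∃ (b : Ideal T.geomFixed) (h : IsGhostPair P₁.under b),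
      comap T.ghostUnit h.toIdeal = P₁ ∧ Q₀.geomPart ≤ b := by
    by_cases hk : ∀ t : T.fixed, T.res t = 0 → Ideal.Quotient.mk T.transferIdeal t ∈ b₁
    · refine ⟨⊤, Or.inl ⟨h₁.isCpPrime, rfl⟩, TIdeal.ext rfl ?_, le_top⟩
      refine Eq.trans ?_ (congrArg TIdeal.fixed hQ₁)
      exact le_antisymm (fun t ht => ⟨ht.1, h₁.mk_mem_of_res_mem hk t ht.1⟩)
        fun t ht => ⟨ht.1, trivial⟩
    · push Not at hk
      obtain ⟨t, ht, htb⟩ := hk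
      have hb₁ : b₁.IsPrime := (h₁.resolve_left fun h => htb (h.2 ▸ trivial)).1
      refine ⟨b₁, h₁, hQ₁, fun y hy => ?_⟩
      obtain ⟨s, rfl⟩ := Ideal.Quotient.mk_surjective y
      -- The first coordinate of the ghost image of `s * t` vanishes, so membership depends only on
      -- the geometric part.
      have hmem : s * t ∈ (comap T.ghostUnit Q₀).fixed := by
        refine mem_ghost_fixed.2 ⟨?_, ?_⟩
        · have : T.resInvariants (s * t) = 0 :=
            Subtype.ext (show T.res (s * t) = 0 by rw [map_mul, ht, mul_zero])
          change T.resInvariants (s * t) ∈ _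
          rw [this]
          exact zero_mem _
        · change Ideal.Quotient.mk T.transferIdeal (s * t) ∈ _
          rw [map_mul]
          exact Ideal.mul_mem_right _ _ hy
      have := hle.2 hmem
      rw [← hQ₁] at this
      have h2 : Ideal.Quotient.mk T.transferIdeal (s * t) ∈ b₁ := this.2
      rw [map_mul] at h2
      exact (hb₁.mem_or_mem h2).resolve_right htb
  -- The inclusion is strict because the preimages `P₀` and `P₁` differ.
  refine ⟨⟨h.toIdeal, h.isPrime⟩, lt_of_le_of_ne ?_ fun he => hne ?_, hQ⟩
  · change Q₀ ≤ h.toIdeal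
    rw [hQ₀.eq_toIdeal]
    exact (IsGhostPair.toIdeal_le_iff _ _).2 ⟨hle.1, hb⟩
  · exact (congrArg (comap T.ghostUnit) (congrArg Subtype.val he)).trans hQ

/-- A fixed point `x` satisfies `x ^ p = res (nm x)`, so it is a root of a monic polynomial over
`T.fixed`; geometric fixed points are a quotient of `T.fixed`. -/
lemma levelwiseIntegral_ghostUnit (T : TambaraFunctor.{u} p) : LevelwiseIntegral T.ghostUnit := by
  refine ⟨fun x => (RingHom.id T.under).isIntegralElem_map (x := x), fun a => ?_⟩
  let := T.resInvariants.toAlgebra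
  obtain ⟨x, y⟩ := a
  refine IsIntegral.pair (R := T.fixed) (A := T.invariants) (B := T.geomFixed) (x := (x, y)) ?_ ?_
  · refine ⟨Polynomial.X ^ Fintype.card (Cp p) - Polynomial.C (T.nm (x : T.under)),
      Polynomial.monic_X_pow_sub_C _ Fintype.card_ne_zero, ?_⟩
    rw [Polynomial.eval₂_sub, Polynomial.eval₂_X_pow, Polynomial.eval₂_C, sub_eq_zero]
    refine Subtype.ext ?_
    change (x : T.under) ^ Fintype.card (Cp p) = T.res (T.nm (x : T.under))
    rw [T.res_nm, ← Finset.card_univ, ← Finset.prod_const]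
    exact Finset.prod_congr rfl fun g _ => (x.2 g).symm
  · obtain ⟨t, rfl⟩ := Ideal.Quotient.mk_surjective y
    exact isIntegral_algebraMap (R := T.fixed) (A := T.geomFixed) (x := t)

/-- The map induced by the ghost map on Nakaoka spectra. -/
def ghostSpecMap (T : TambaraFunctor.{u} p) (Q : T.ghost.Spec) : T.Spec :=
  ⟨comap T.ghostUnit Q.1, by rw [Q.2.eq_toIdeal]; exact IsGhostPair.isPrime_comap _⟩

lemma isClosed_iff_exists_zeroLocus {Z : Set T.Spec} :
    IsClosed Z ↔ ∃ I : TIdeal T, zeroLocus I = Z := by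
  rw [← isOpen_compl_iff]
  change Zᶜᶜ ∈ Set.range zeroLocus ↔ _
  rw [compl_compl]
  rfl

lemma continuous_ghostSpecMap (T : TambaraFunctor.{u} p) : Continuous T.ghostSpecMap := by
  refine continuous_iff_isClosed.2 fun Z hZ => ?_
  obtain ⟨I, rfl⟩ := isClosed_iff_exists_zeroLocus.1 hZ
  exact isClosed_iff_exists_zeroLocus.2 ⟨_, Set.ext fun Q =>
    generate_image_le_iff_le_comap T.ghostUnit I Q.1⟩

lemma surjective_ghostSpecMap (T : TambaraFunctor.{u} p) :
    Function.Surjective T.ghostSpecMap := by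
  rintro ⟨P, hP⟩
  obtain ⟨b, h, hQ⟩ := hP.exists_comap_eq
  exact ⟨⟨h.toIdeal, h.isPrime⟩, Subtype.ext hQ⟩

/-! ### The spectrum of the ghost as a poset. -/

/-- The primes of the ghost are the pairs `(a; b)`. -/
def ghostSpecOrderIso (T : TambaraFunctor.{u} p) : T.ghost.Spec ≃o T.GhostPairs where
  toFun Q := ⟨(Q.1.under, Q.1.geomPart), Q.2.isGhostPair⟩
  invFun c := ⟨IsGhostPair.toIdeal (a := c.1.1) (b := c.1.2) c.2, IsGhostPair.isPrime _⟩
  left_inv Q := Subtype.ext Q.2.eq_toIdeal.symm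
  right_inv c := Subtype.ext (Prod.ext rfl (IsGhostPair.toIdeal_geomPart c.2))
  map_rel_iff' {Q Q'} := by
    change _ ↔ Q.1 ≤ Q'.1
    rw [Q.2.eq_toIdeal, Q'.2.eq_toIdeal]
    exact (IsGhostPair.toIdeal_le_iff _ _).symm

/-- A pair `(a; b)` is determined by the fixed points of `a` together with `b`. -/
noncomputable def ghostPairsOrderIso (T : TambaraFunctor.{u} p) :
    T.GhostPairs ≃o T.GhostPairsFixed :=
  RelIso.ofSurjective
    (OrderEmbedding.ofMapLEIff
      (fun c : T.GhostPairs => (⟨(c.1.1.comap T.invariants.subtype, c.1.2),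
        c.2.imp (fun h => ⟨h.1.isPrime_comap_subtype, h.2⟩)
          (fun h => ⟨h.1, congrArg (Ideal.comap T.invariants.subtype) h.2⟩)⟩ : T.GhostPairsFixed))
      -- Both kinds of pair have a `C_p`-prime first component, so inclusion can be read off the
      -- fixed points.
      fun c d => ⟨fun h => ⟨(IsGhostPair.isCpPrime d.2).le_of_comap_subtype_le
        (IsGhostPair.isCpPrime c.2).1 h.1, h.2⟩, fun h => ⟨Ideal.comap_mono h.1, h.2⟩⟩)
    (by
      rintro ⟨⟨a, b⟩, ⟨ha, hb⟩ | ⟨hb, ha⟩⟩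
      · obtain ⟨c, hc, hca⟩ := exists_isCpPrime_comap_subtype_eq a
        exact ⟨⟨(c, b), Or.inl ⟨hc, hb⟩⟩, Subtype.ext (Prod.ext hca rfl)⟩
      · exact ⟨⟨(b.comap T.geomNorm, b), Or.inr ⟨hb, rfl⟩⟩, Subtype.ext (Prod.ext ha.symm rfl)⟩)

/-- The pairs of ideals of the fixed points and of the geometric fixed points are indexed by the
prime ideals of the two rings. -/
noncomputable def sumEquivGhostPairsFixed (T : TambaraFunctor.{u} p) :
    PrimeSpectrum T.invariants ⊕ PrimeSpectrum T.geomFixed ≃ T.GhostPairsFixed :=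
  Equiv.ofBijective
    (Sum.elim (fun a => ⟨(a.asIdeal, ⊤), Or.inl ⟨a.2, rfl⟩⟩)
      fun b => ⟨((b.asIdeal.comap T.geomNorm).comap T.invariants.subtype, b.asIdeal),
        Or.inr ⟨b.2, rfl⟩⟩)
    (by
      constructor
      -- The two summands have disjoint images: the second component is `⊤` on one and proper on the
      -- other.
      · rintro (a | a) (b | b) h <;>
          have h2 := congrArg Prod.snd (Subtype.ext_iff.1 h)
        · exact congrArg Sum.inl (PrimeSpectrum.ext (congrArg Prod.fst (Subtype.ext_iff.1 h)))
        · exact absurd h2.symm b.2.ne_top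
        · exact absurd h2 a.2.ne_top
        · exact congrArg Sum.inr (PrimeSpectrum.ext h2)
      · rintro ⟨⟨a, b⟩, ⟨ha, hb⟩ | ⟨hb, ha⟩⟩
        · exact ⟨Sum.inl ⟨a, ha⟩, Subtype.ext (Prod.ext rfl hb.symm)⟩
        · exact ⟨Sum.inr ⟨b, hb⟩, Subtype.ext (Prod.ext ha.symm rfl)⟩)

lemma fixed_eq_prod_ghostPairsOrderIso (T : TambaraFunctor.{u} p) (Q : T.ghost.Spec) :
    Q.1.fixed = Ideal.prod (T.ghostPairsOrderIso (T.ghostSpecOrderIso Q)).1.1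
      (T.ghostPairsOrderIso (T.ghostSpecOrderIso Q)).1.2 :=
  Q.2.isPair.2

/-! ### The monad structure. -/

lemma ghostMap_fixed_mk {S T : TambaraFunctor.{u} p} (f : S ⟶ T) (x : S.invariants) (b : S.fixed) :
    Hom.fixed (ghostMap f) (x, Ideal.Quotient.mk S.transferIdeal b) =
      (invariantsMap f x, Ideal.Quotient.mk T.transferIdeal (Hom.fixed f b)) :=
  rfl

/-- On a representative `(x, [(y, w)])` both composites keep `x`, discard `y` and apply the quotient
part of `T.ghostMul` to the remaining geometric coordinate. -/
lemma ghostMul_assoc (T : TambaraFunctor.{u} p) :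
    (ghostFunctor p).map T.ghostMul ≫ T.ghostMul = T.ghost.ghostMul ≫ T.ghostMul := by
  refine Hom.ext rfl (RingHom.ext fun a => ?_)
  obtain ⟨x, b⟩ := a
  obtain ⟨⟨y, w⟩, rfl⟩ := Ideal.Quotient.mk_surjective b
  exact (congrArg (Hom.fixed T.ghostMul) (ghostMap_fixed_mk T.ghostMul x (y, w))).trans rfl

/-- The ghost monad. -/
def ghostMonad (p : ℕ) [Fact p.Prime] : Monad (TambaraFunctor.{u} p) where
  toFunctor := ghostFunctor p
  η :=
    { app := ghostUnit
      naturality := fun S T f => Hom.ext rfl (RingHom.ext fun a =>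
        Prod.ext (Subtype.ext (Hom.map_res f a).symm) rfl) }
  μ :=
    { app := ghostMul
      naturality := fun S T f => Hom.ext rfl (RingHom.ext fun a => Prod.ext rfl (by
        obtain ⟨a, b⟩ := a
        obtain ⟨b, rfl⟩ := Ideal.Quotient.mk_surjective b
        rfl)) }
  assoc := ghostMul_assoc
  left_unit T := Hom.ext rfl rfl
  right_unit T := Hom.ext rfl (RingHom.ext fun a => Prod.ext rfl (by
    obtain ⟨a, b⟩ := a
    obtain ⟨b, rfl⟩ := Ideal.Quotient.mk_surjective b
    rfl))

end TambaraFunctor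

theorem theoremE (p : ℕ) [Fact p.Prime] :
    -- the ghost functor is a monad, with the ghost map as its unit
    (∃ (η : 𝟭 (TambaraFunctor.{u} p) ⟶ TambaraFunctor.ghostFunctor p)
        (μ : TambaraFunctor.ghostFunctor p ⋙ TambaraFunctor.ghostFunctor p ⟶
          TambaraFunctor.ghostFunctor p),
      (∀ T : TambaraFunctor.{u} p, η.app T = T.ghostUnit) ∧
      (∀ T : TambaraFunctor.{u} p, μ.app T = T.ghostMul) ∧
      ∃ M : Monad (TambaraFunctor.{u} p),
        M.toFunctor = TambaraFunctor.ghostFunctor p ∧ HEq M.η η ∧ HEq M.μ μ) ∧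
    ∀ T : TambaraFunctor.{u} p,
      -- the ghost map is levelwise integral and satisfies going up
      TambaraFunctor.LevelwiseIntegral T.ghostUnit ∧
      TambaraFunctor.GoingUp T.ghostUnit ∧
      -- pulling back along the ghost map is a continuous surjection on Nakaoka spectra
      (∃ φ : T.ghost.Spec → T.Spec,
        (∀ Q, (φ Q).1 = TambaraFunctor.TIdeal.comap T.ghostUnit Q.1) ∧
        Continuous φ ∧ Function.Surjective φ) ∧
      -- the primes of the ghost are exactly the pairs of the two kinds, ordered componentwise
      (∃ e : T.ghost.Spec ≃o T.GhostPairs,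
        ∀ Q, TambaraFunctor.IsPair Q.1 (e Q).1.1 (e Q).1.2) ∧
      -- the same with prime ideals of the ring of fixed points
      (∃ e : T.ghost.Spec ≃o T.GhostPairsFixed,
        ∀ Q, Q.1.fixed = Ideal.prod (e Q).1.1 (e Q).1.2) ∧
      -- the resulting bijection with a disjoint union of spectra
      (∃ e : PrimeSpectrum T.invariants ⊕ PrimeSpectrum T.geomFixed ≃ T.ghost.Spec,
        (∀ a : PrimeSpectrum T.invariants,
          (e (Sum.inl a)).1.fixed = Ideal.prod a.asIdeal ⊤) ∧
        (∀ b : PrimeSpectrum T.geomFixed,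
          TambaraFunctor.IsPair (e (Sum.inr b)).1
            (b.asIdeal.comap T.geomNorm) b.asIdeal)) := by

  refine ⟨⟨(TambaraFunctor.ghostMonad p).η, (TambaraFunctor.ghostMonad p).μ, fun _ => rfl,
    fun _ => rfl, TambaraFunctor.ghostMonad p, rfl, HEq.rfl, HEq.rfl⟩, fun T => ?_⟩
  refine ⟨T.levelwiseIntegral_ghostUnit, T.goingUp_ghostUnit,
    ⟨T.ghostSpecMap, fun _ => rfl, T.continuous_ghostSpecMap, T.surjective_ghostSpecMap⟩,
    ⟨T.ghostSpecOrderIso, fun Q => Q.2.isPair⟩,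
    ⟨T.ghostSpecOrderIso.trans T.ghostPairsOrderIso, T.fixed_eq_prod_ghostPairsOrderIso⟩,
    T.sumEquivGhostPairsFixed.trans
      (T.ghostSpecOrderIso.trans T.ghostPairsOrderIso).symm.toEquiv, fun a => ?_, fun b => ?_⟩
  · refine (T.fixed_eq_prod_ghostPairsOrderIso _).trans ?_
    simp only [Equiv.trans_apply, RelIso.coe_fn_toEquiv, OrderIso.symm_trans_apply,
      OrderIso.apply_symm_apply]
    rfl
  · have h : T.sumEquivGhostPairsFixed (Sum.inr b) =
        T.ghostPairsOrderIso ⟨(b.asIdeal.comap T.geomNorm, b.asIdeal), Or.inr ⟨b.2, rfl⟩⟩ := rfl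
    simp only [Equiv.trans_apply, h]
    simp only [RelIso.coe_fn_toEquiv, OrderIso.symm_trans_apply, OrderIso.symm_apply_apply]
    exact ⟨rfl, rfl⟩
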